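/- Let $W\in\mathbb{C}[x_1,\dots,x_N]$ be quasihomogeneous of degree $d>0$ with positive integer weights $c_1,\dots,c_N$, let $q_i=c_i/d$ be its charges, and let $c_W=\sum_{i=1}^N(1-2q_i)$. Assume that $W$ is nondegenerate (the origin is its only critical point, and it has no monomial $x_ix_j$ with $i\neq j$) and invertible (it has exactly $N$ monomials). Let $G$ be a group of diagonal matrices with entries in $U(1)$ that preserve $W$, and assume $J=\mathrm{diag}(e^{2\pi i q_1},\dots,e^{2\pi i q_N})\in G$. For $g\in G$ let $W_g$ be the restriction of $W$ to the coordinate subspace $\mathrm{Fix}(g)\subseteq\mathbb{C}^N$, of dimension $n=n_g$, let $d\underline{x}_g$ be the product of the $dx_i$ with $g_i=1$, and let $\Omega_{W_g}=\Omega^{n}(\mathrm{Fix}(g))/(dW_g\wedge\Omega^{n-1}(\mathrm{Fix}(g)))$ (polynomial forms), graded by $\deg(\phi\,d\underline{x}_g)=\deg\phi+\sum_{g_i=1}q_i$, where $\deg x_i=q_i$. Let $\Omega_{W,G}=\bigl(\bigoplus_{g\in G}\Omega_{W_g}\bigr)^G$, with $G$ acting by pullback. Writing $g=\mathrm{diag}(e^{2\pi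 i\Theta_1},\dots,e^{2\pi i\Theta_N})$ with $\Theta_i\in[0,1)$, put $\iota_{(g)}=\sum_i\Theta_i$ and $$Q^B_-(g)=\iota_{(g^{-1})}-\sum_{i=1}^N q_i,\qquad Q^B_+(g)=\iota_{(g)}-\sum_{i=1}^N q_i .$$ The shifted bidegree of a homogeneous element $\phi\,d\underline{x}_g$ of the $g$-sector is $(\deg_W^-,\deg_W^+)=(\deg(\phi\,d\underline{x}_g)+Q^B_-(g),\ \deg(\phi\,d\underline{x}_g)+Q^B_+(g))$. The residue pairing between the $g$-sector and the $g^{-1}$-sector is defined, using $\mathrm{Fix}(g)=\mathrm{Fix}(g^{-1})$, by $$\langle\phi_1\,d\underline{x}_g,\ \phi_2\,d\underline{x}_{g^{-1}}\rangle=\frac{1}{(2\pi i)^{n}}\int_{|\partial_iW_g|=\varepsilon}\frac{\phi_1\phi_2\,d\underline{x}_g}{\prod_{i}\partial_iW_g},$$ where $i$ runs over the indices with $g_i=1$, $\varepsilon>0$, and the cycle is oriented by $\bigwedge_i d\arg(\partial_iW_g)>0$. Then for every $g\in G$ and all homogeneous $\phi_1\,d\underline{x}_g$ in the $g$-sector and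 $\phi_2\,d\underline{x}_{g^{-1}}$ in the $g^{-1}$-sector with $\langle\phi_1\,d\underline{x}_g,\phi_2\,d\underline{x}_{g^{-1}}\rangle\neq0$, $$\deg_W^{-}(\phi_1\,d\underline{x}_g)+\deg_W^{-}(\phi_2\,d\underline{x}_{g^{-1}})=c_W\quad\text{and}\quad\deg_W^{+}(\phi_1\,d\underline{x}_g)+\deg_W^{+}(\phi_2\,d\underline{x}_{g^{-1}})=c_W .$$ This holds both for homogeneous forms and for homogeneous classes in $\Omega_{W,G}$. -/

import Mathlib

open MvPolynomial MeasureTheory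

namespace LG

noncomputable section

/-! ### Quasihomogeneous polynomials, charges, symmetries -/

/-- `W` is quasihomogeneous with (positive integer) weights `c` and (positive) degree `d`. -/
structure IsQuasihomogeneous {N : ℕ} (W : MvPolynomial (Fin N) ℂ) (c : Fin N → ℕ) (d : ℕ) :
    Prop where
  degree_pos : 0 < d
  weight_pos : ∀ i, 0 < c i
  homogeneous : W.IsWeightedHomogeneous c d

/-- Nondegeneracy: the origin is the only critical point of `W`, and `W` has no monomial
`x_i x_j` with `i ≠ j`. -/
structure IsNondegenerate {N : ℕ} (W : MvPolynomial (Fin N) ℂ) : Prop where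
  critical_iff : ∀ x : Fin N → ℂ, (∀ i, eval x (pderiv i W) = 0) ↔ x = 0
  no_cross_term : ∀ i j, i ≠ j → coeff (Finsupp.single i 1 + Finsupp.single j 1) W = 0

/-- Invertibility: as many monomials as variables. -/
def IsInvertible {N : ℕ} (W : MvPolynomial (Fin N) ℂ) : Prop := W.support.card = N

/-- The charges `q_i = c_i / d`. -/
def charge {N : ℕ} (c : Fin N → ℕ) (d : ℕ) (i : Fin N) : ℝ := (c i : ℝ) / (d : ℝ)

/-- The central charge `c_W = ∑ (1 - 2 q_i)`. -/
def centralCharge {N : ℕ} (c : Fin N → ℕ) (d : ℕ) : ℝ := ∑ i, (1 - 2 * charge c d i)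

/-- The maximal diagonal symmetry group: diagonal matrices `diag(g_1, …, g_N)` with entries
`g_j = e^{2πi θ_j}` on the unit circle such that `W(g x) = W(x)`. -/
def maxSymm {N : ℕ} (W : MvPolynomial (Fin N) ℂ) : Subgroup (Fin N → Circle) where
  carrier := {g | ∀ x : Fin N → ℂ, eval (fun i => (g i : ℂ) * x i) W = eval x W}
  one_mem' := by intro x; simp
  mul_mem' := by
    intro a b ha hb x
    have := ha (fun i => (b i : ℂ) * x i)
    rw [hb x] at this
    simpa [mul_assoc] using this
  inv_mem' := by
    intro a ha x
    have := ha (fun i => ((a i)⁻¹ : ℂ) * x i)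
    simpa using this.symm

/-- The distinguished element `J = diag(e^{2πi q_1}, …, e^{2πi q_N})`. -/
def J {N : ℕ} (c : Fin N → ℕ) (d : ℕ) : Fin N → Circle :=
  fun i => Circle.exp (2 * Real.pi * charge c d i)

/-- The `i`-th phase of `g`: the number `Θ_i ∈ [0,1)` with `g_i = e^{2πi Θ_i}`. -/
def phase {N : ℕ} (g : Fin N → Circle) (i : Fin N) : ℝ :=
  Int.fract (Complex.arg (g i : ℂ) / (2 * Real.pi))

/-- The age `ι_(g) = ∑ Θ_i`. -/
def age {N : ℕ} (g : Fin N → Circle) : ℝ := ∑ i, phase g i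

/-- The degree shift `Q^B_-(g) = ι_(g⁻¹) - ∑ q_i`. -/
def shiftMinus {N : ℕ} (c : Fin N → ℕ) (d : ℕ) (g : Fin N → Circle) : ℝ :=
  age g⁻¹ - ∑ i, charge c d i

/-- The degree shift `Q^B_+(g) = ι_(g) - ∑ q_i`. -/
def shiftPlus {N : ℕ} (c : Fin N → ℕ) (d : ℕ) (g : Fin N → Circle) : ℝ :=
  age g - ∑ i, charge c d i

open Classical in
/-- The coordinates fixed by `g`; `Fix(g)` is the coordinate subspace `ℂ^(fixIdx g)` of `ℂ^N`. -/
def fixIdx {N : ℕ} (g : Fin N → Circle) : Finset (Fin N) := Finset.univ.filter fun i => g i = 1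

/-- `Fix(g⁻¹) = Fix(g)`. -/
theorem fixIdx_inv {N : ℕ} (g : Fin N → Circle) : fixIdx g⁻¹ = fixIdx g := by
  ext i; simp [fixIdx]

open Classical in
/-- Restriction of a polynomial to the coordinate subspace `ℂ^S ⊆ ℂ^N` (the coordinates outside
`S` are set to zero). -/
def restrict {N : ℕ} (W : MvPolynomial (Fin N) ℂ) (S : Finset (Fin N)) : MvPolynomial S ℂ :=
  aeval (fun i => if h : i ∈ S then (X ⟨i, h⟩ : MvPolynomial S ℂ) else 0) W

/-! ### The spaces `Ω_{W_g}`

A top-degree polynomial form `φ dx_S` on `ℂ^S` is represented by its coefficient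
`φ : MvPolynomial S ℂ`. -/

/-- Wedge product with `dV` from forms of degree one less than the top degree to top forms:
`η = ∑ (-1)^(i-1) a_i dx_1 ⋯ (omit dx_i) ⋯ dx_n` goes to `dV ∧ η = (∑ a_i ∂_i V) dx`. -/
def wedgeD {σ : Type} [Fintype σ] (V : MvPolynomial σ ℂ) :
    (σ → MvPolynomial σ ℂ) →ₗ[ℂ] MvPolynomial σ ℂ where
  toFun a := ∑ i, a i * pderiv i V
  map_add' a b := by simp [add_mul, Finset.sum_add_distrib]
  map_smul' r a := by simp [Finset.smul_sum]

/-- `Ω_{W|ℂ^S} = Ω^top(ℂ^S) / (dW ∧ Ω^(top-1)(ℂ^S))`. -/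
abbrev Omega {N : ℕ} (W : MvPolynomial (Fin N) ℂ) (S : Finset (Fin N)) : Type :=
  MvPolynomial S ℂ ⧸ LinearMap.range (wedgeD (restrict W S))

/-- Top forms `φ dx_S` on `ℂ^S` that are homogeneous of degree `p`, where
`deg (φ dx_S) = deg φ + ∑_{i ∈ S} q_i` and `x_i` has degree `q_i`. -/
def homForms {N : ℕ} (c : Fin N → ℕ) (d : ℕ) (S : Finset (Fin N)) (p : ℝ) :
    Submodule ℂ (MvPolynomial S ℂ) :=
  weightedHomogeneousSubmodule ℂ (fun i : S => charge c d i) (p - ∑ i ∈ S, charge c d i)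

/-- The degree `p` part of `Ω_{W|ℂ^S}`. -/
def omegaDeg {N : ℕ} (W : MvPolynomial (Fin N) ℂ) (c : Fin N → ℕ) (d : ℕ) (S : Finset (Fin N))
    (p : ℝ) : Submodule ℂ (Omega W S) :=
  (homForms c d S p).map (LinearMap.range (wedgeD (restrict W S))).mkQ

open Classical in
/-- The unshifted (internal) bigrading: the single grading placed on the diagonal. -/
def omegaBideg {N : ℕ} (W : MvPolynomial (Fin N) ℂ) (c : Fin N → ℕ) (d : ℕ) (S : Finset (Fin N))
    (p q : ℝ) : Submodule ℂ (Omega W S) :=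
  if p = q then omegaDeg W c d S p else ⊥

/-! ### The group action and the space `Ω_{W,G}` -/

/-- `φ(x) ↦ φ(h x)` for functions on `ℂ^S`. -/
def scale {N : ℕ} (h : Fin N → Circle) (S : Finset (Fin N)) :
    MvPolynomial S ℂ →ₐ[ℂ] MvPolynomial S ℂ :=
  aeval fun i => C (h i : ℂ) * X i

/-- Pullback of top forms under multiplication by `h`:
`φ(x) dx_S ↦ φ(h x) (∏_{i ∈ S} h_i) dx_S`. -/
def pullback {N : ℕ} (h : Fin N → Circle) (S : Finset (Fin N)) :
    MvPolynomial S ℂ →ₗ[ℂ] MvPolynomial S ℂ :=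
  (∏ i ∈ S, (h i : ℂ)) • (scale h S).toLinearMap

theorem pderiv_scale {N : ℕ} (h : Fin N → Circle) (S : Finset (Fin N)) (i : S)
    (φ : MvPolynomial S ℂ) :
    pderiv i (scale h S φ) = C (h i : ℂ) * scale h S (pderiv i φ) := by
  induction φ using MvPolynomial.induction_on with
  | C a => simp [scale]
  | add p q hp hq => simp [hp, hq, mul_add]
  | mul_X p j hp =>
    have hX : ∀ j : S, scale h S (X j) = C (h j : ℂ) * X j := fun j => by simp [scale]
    simp only [map_mul, Derivation.leibniz, hp, hX, smul_eq_mul, map_add]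
    by_cases hij : i = j
    · subst hij; simp; ring
    · simp [pderiv_X, Ne.symm hij]; ring

theorem scale_restrict {N : ℕ} {W : MvPolynomial (Fin N) ℂ} {h : Fin N → Circle}
    (hh : h ∈ maxSymm W) (S : Finset (Fin N)) : scale h S (restrict W S) = restrict W S := by
  classical
  apply MvPolynomial.funext
  intro x
  have key : ∀ z : S → ℂ, eval z (restrict W S)
      = eval (fun i => if hi : i ∈ S then z ⟨i, hi⟩ else 0) W := by
    intro z
    simp only [restrict, ← coe_aeval_eq_eval, RingHom.coe_coe]
    rw [comp_aeval_apply]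
    congr 2
    funext i
    split_ifs <;> simp
  have e1 : eval x (scale h S (restrict W S))
      = eval (fun i : S => (h i : ℂ) * x i) (restrict W S) := by
    simp only [scale, ← coe_aeval_eq_eval, RingHom.coe_coe]
    rw [comp_aeval_apply]
    congr 2
    funext i
    simp
  rw [e1, key, key, ← hh fun i => if hi : i ∈ S then x ⟨i, hi⟩ else 0]
  congr 2
  funext i
  split_ifs <;> simp

theorem range_le_comap_pullback {N : ℕ} {W : MvPolynomial (Fin N) ℂ} {h : Fin N → Circle}
    (hh : h ∈ maxSymm W) (S : Finset (Fin N)) :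
    LinearMap.range (wedgeD (restrict W S)) ≤
      (LinearMap.range (wedgeD (restrict W S))).comap (pullback h S) := by
  rintro _ ⟨a, rfl⟩
  have hd : ∀ i : S, scale h S (pderiv i (restrict W S))
      = C ((h i : ℂ)⁻¹) * pderiv i (restrict W S) := by
    intro i
    have h1 := pderiv_scale h S i (restrict W S)
    rw [scale_restrict hh] at h1
    conv_rhs => rw [h1, ← mul_assoc, ← C_mul, inv_mul_cancel₀ (Circle.coe_ne_zero _)]
    simp
  refine ⟨fun i => (∏ i ∈ S, (h i : ℂ)) • (scale h S (a i) * C ((h i : ℂ)⁻¹)), ?_⟩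
  simp only [wedgeD, pullback, LinearMap.coe_mk, AddHom.coe_mk, LinearMap.smul_apply,
    AlgHom.toLinearMap_apply, map_sum, map_mul, hd, smul_mul_assoc, mul_assoc]

/-- The action of a symmetry `h` on `Ω_{W|ℂ^S}` by pullback. -/
def omegaAct {N : ℕ} {W : MvPolynomial (Fin N) ℂ} {h : Fin N → Circle} (hh : h ∈ maxSymm W)
    (S : Finset (Fin N)) : Omega W S →ₗ[ℂ] Omega W S :=
  Submodule.mapQ _ _ (pullback h S) (range_le_comap_pullback hh S)

/-- `⨁_{g ∈ G} Ω_{W_g}`, with `W_g` the restriction of `W` to `Fix(g)`. -/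
abbrev SectorSum {N : ℕ} (W : MvPolynomial (Fin N) ℂ) (G : Subgroup (Fin N → Circle)) : Type :=
  DirectSum G fun g => Omega W (fixIdx (g : Fin N → Circle))

/-- The action of `h ∈ G` on `⨁_{g ∈ G} Ω_{W_g}`. It sends the sector of `g` to the sector of
`h⁻¹ g h`, which is the sector of `g` because diagonal matrices commute. -/
def sectorAct {N : ℕ} {W : MvPolynomial (Fin N) ℂ} {G : Subgroup (Fin N → Circle)}
    (hG : G ≤ maxSymm W) (h : G) : SectorSum W G →ₗ[ℂ] SectorSum W G :=
  DirectSum.lmap fun g => omegaAct (hG h.2) (fixIdx (g : Fin N → Circle))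

/-- The B-model cohomology `Ω_{W,G}`: the `G`-invariants of `⨁_{g ∈ G} Ω_{W_g}`. -/
def OmegaG {N : ℕ} {W : MvPolynomial (Fin N) ℂ} {G : Subgroup (Fin N → Circle)}
    (hG : G ≤ maxSymm W) : Submodule ℂ (SectorSum W G) :=
  ⨅ h : G, LinearMap.eqLocus (sectorAct hG h) LinearMap.id

/-- The part of `Ω_{W,G}` of shifted bidegree `(deg⁻, deg⁺) = (p, q)`:
the `G`-invariants of `⨁_g Ω_{W_g}^{p - Q^B_-(g), q - Q^B_+(g)}`. -/
def OmegaGBideg {N : ℕ} {W : MvPolynomial (Fin N) ℂ} {G : Subgroup (Fin N → Circle)}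
    (hG : G ≤ maxSymm W) (c : Fin N → ℕ) (d : ℕ) (p q : ℝ) : Submodule ℂ (SectorSum W G) :=
  OmegaG hG ⊓ ⨅ g : G, (omegaBideg W c d (fixIdx (g : Fin N → Circle))
    (p - shiftMinus c d g) (q - shiftPlus c d g)).comap
      (DirectSum.component ℂ G (fun g => Omega W (fixIdx (g : Fin N → Circle))) g)

/-! ### The residue pairing -/

/-- The cycle `{x ∈ ℂ^σ : |∂_i V(x)| = ε for all i}`. -/
def cycle {σ : Type} [Fintype σ] (V : MvPolynomial σ ℂ) (ε : ℝ) : Set (EuclideanSpace ℂ σ) :=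
  {x | ∀ i, ‖eval x.ofLp (pderiv i V)‖ = ε}

/-- The Hessian matrix `(∂_i ∂_j V)(x)`, i.e. the complex Jacobian matrix at `x` of the gradient
map `(∂_1 V, …, ∂_n V)`. -/
def hessian {σ : Type} [Fintype σ] (V : MvPolynomial σ ℂ) (x : EuclideanSpace ℂ σ) :
    Matrix σ σ ℂ :=
  Matrix.of fun i j => eval x.ofLp (pderiv j (pderiv i V))

open Classical in
/-- The tangent frame of `cycle V ε` at `x`, as columns: the `j`-th column is the velocity with
which `x` moves along the cycle when `arg (∂_j V)` increases at unit speed and the other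
`∂_i V` stay fixed. It is a basis of the tangent space wherever the Hessian
determinant does not vanish, which is almost everywhere on the cycle. -/
def frame {σ : Type} [Fintype σ] (V : MvPolynomial σ ℂ) (x : EuclideanSpace ℂ σ) :
    Matrix σ σ ℂ :=
  (hessian V x)⁻¹ * Matrix.diagonal fun j => Complex.I * eval x.ofLp (pderiv j V)

open Classical in
/-- The value of `dx_1 ∧ ⋯ ∧ dx_n` on the unit tangent `n`-vector of `cycle V ε` at `x`, for the
orientation `d arg (∂_1 V) ∧ ⋯ ∧ d arg (∂_n V) > 0`: the value on the frame divided by the real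
`n`-dimensional volume of the parallelepiped that the frame spans. -/
def dxOnTangent {σ : Type} [Fintype σ] (V : MvPolynomial σ ℂ) (x : EuclideanSpace ℂ σ) : ℂ :=
  (frame V x).det /
    (Real.sqrt (((frame V x).conjTranspose * frame V x).map Complex.re).det : ℂ)

/-- The residue
`Res (φ dx / (∂_1 V ⋯ ∂_n V)) = (2πi)^(-n) ∫_{|∂_i V| = ε} φ dx / (∂_1 V ⋯ ∂_n V)`,
where the integral of the form over the oriented `n`-dimensional cycle is the integral, against
`n`-dimensional Euclidean Hausdorff measure, of its value on the unit tangent `n`-vector. -/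
def residue {σ : Type} [Fintype σ] (V : MvPolynomial σ ℂ) (ε : ℝ) (φ : MvPolynomial σ ℂ) : ℂ :=
  ((2 * Real.pi * Complex.I) ^ Fintype.card σ)⁻¹ *
    ∫ x in cycle V ε, eval x.ofLp φ / (∏ i, eval x.ofLp (pderiv i V)) * dxOnTangent V x
      ∂(Measure.euclideanHausdorffMeasure (Fintype.card σ))

/-- Transport of forms along an equality of coordinate subspaces. -/
def castForm {N : ℕ} {S T : Finset (Fin N)} (h : T = S) (φ : MvPolynomial T ℂ) :
    MvPolynomial S ℂ :=
  rename (fun i : T => (⟨i.1, h ▸ i.2⟩ : S)) φ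

/-- The residue pairing `⟨φ₁ dx_g, φ₂ dx_{g⁻¹}⟩` of forms on `Fix(g)` and `Fix(g⁻¹) = Fix(g)`. -/
def formPairing {N : ℕ} (W : MvPolynomial (Fin N) ℂ) (ε : ℝ) (g : Fin N → Circle)
    (φ₁ : MvPolynomial (fixIdx g) ℂ) (φ₂ : MvPolynomial (fixIdx g⁻¹) ℂ) : ℂ :=
  residue (restrict W (fixIdx g)) ε (φ₁ * castForm (fixIdx_inv g) φ₂)

open Classical in
/-- The residue pairing `Ω_{W_g} × Ω_{W_{g⁻¹}} → ℂ` of classes: the common value of the residue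
pairing on all pairs of representing forms. It exists because residues with a numerator in
`dW_g ∧ Ω^(top-1)` vanish; the value `0` is a convention for the case that it did not exist. -/
def pairing {N : ℕ} (W : MvPolynomial (Fin N) ℂ) (ε : ℝ) (g : Fin N → Circle)
    (ω₁ : Omega W (fixIdx g)) (ω₂ : Omega W (fixIdx g⁻¹)) : ℂ :=
  if h : ∃ z : ℂ, ∀ φ₁ φ₂, Submodule.Quotient.mk φ₁ = ω₁ → Submodule.Quotient.mk φ₂ = ω₂ →
      formPairing W ε g φ₁ φ₂ = z
  then h.choose else 0

end

end LG

/-!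
Let `ψ` be a character of `ℝ`. Rotating each coordinate `x_i` by `ψ(q_i)` is an isometry that
multiplies a quasihomogeneous polynomial of degree `m` by the scalar `ψ(m)`. Hence it preserves
the cycle `|∂_i W_g| = ε` and multiplies the residue integrand by `ψ` of its total degree, so a
nonzero residue forces this degree to vanish, because characters separate the points of `ℝ`.
Thus the unshifted degrees of two forms that pair nontrivially add up to `dim Fix(g)`, and
`ι_(g) + ι_(g⁻¹) = N - dim Fix(g)` accounts for the difference to `c_W`.
-/

namespace LG

noncomputable section

section WeightedHomogeneous

variable {R σ τ M M' : Type*} [CommSemiring R] [AddCommMonoid M] [AddCommMonoid M']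
  {w : σ → M} {m : M} {p : MvPolynomial σ R}

theorem addChar_sum {ι : Type*} (χ : AddChar M R) (f : ι → M) (s : Finset ι) :
    χ (∑ i ∈ s, f i) = ∏ i ∈ s, χ (f i) :=
  map_sum χ.toAddMonoidHom f s

theorem addChar_weight (χ : AddChar M R) (w : σ → M) (k : σ →₀ ℕ) :
    χ (Finsupp.weight w k) = ∏ i ∈ k.support, χ (w i) ^ k i := by
  simp only [Finsupp.weight_apply, Finsupp.sum, addChar_sum, AddChar.map_nsmul_eq_pow]

theorem eval_addChar_mul (hp : p.IsWeightedHomogeneous w m) (χ : AddChar M R) (x : σ → R) :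
    eval (fun i => χ (w i) * x i) p = χ m * eval x p := by
  rw [eval_eq, eval_eq, Finset.mul_sum]
  refine Finset.sum_congr rfl fun k hk => ?_
  rw [← hp (mem_support_iff.1 hk), addChar_weight]
  simp only [mul_pow, Finset.prod_mul_distrib]
  ring

theorem isWeightedHomogeneous_map_weight (hp : p.IsWeightedHomogeneous w m) (f : M →+ M') :
    p.IsWeightedHomogeneous (fun i => f (w i)) (f m) := fun k hk => by
  simp only [← hp hk, Finsupp.weight_apply, map_finsuppSum, map_nsmul]

theorem isWeightedHomogeneous_aeval (hp : p.IsWeightedHomogeneous w m) {v : τ → M}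
    {f : σ → MvPolynomial τ R} (hf : ∀ i, (f i).IsWeightedHomogeneous v (w i)) :
    (aeval f p).IsWeightedHomogeneous v m := by
  rw [aeval_def, eval₂_eq]
  refine IsWeightedHomogeneous.sum _ _ _ fun k hk => IsWeightedHomogeneous.C_mul ?_ _
  rw [← hp (mem_support_iff.1 hk), Finsupp.weight_apply]
  exact IsWeightedHomogeneous.prod _ _ _ fun i _ => (hf i).pow _

end WeightedHomogeneous

theorem exists_addChar_ne_one {r : ℝ} (hr : r ≠ 0) : ∃ ψ : AddChar ℝ Circle, ψ r ≠ 1 := by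
  refine ⟨Real.probChar.mulShift (Real.pi / r), fun h => ?_⟩
  rw [AddChar.mulShift_apply, div_mul_cancel₀ _ hr, Real.probChar_apply'] at h
  norm_num [Circle.ext_iff, Circle.coe_exp] at h

theorem coe_addChar_sum {σ : Type*} [Fintype σ] (ψ : AddChar ℝ Circle) (v : σ → ℝ) :
    (ψ (∑ i, v i) : ℂ) = ∏ i, (ψ (v i) : ℂ) :=
  addChar_sum (Circle.coeHom.compAddChar ψ) v Finset.univ

section CharDiagonal

variable {σ : Type*} [DecidableEq σ] (ψ : AddChar ℝ Circle) (v : σ → ℝ)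

/-- The diagonal unitary matrix with entries `ψ(v_i)`. The Hessian and the tangent frame of a
quasihomogeneous polynomial transform under coordinate rotations by such matrices. -/
def charDiagonal : Matrix σ σ ℂ := Matrix.diagonal fun i => (ψ (v i) : ℂ)

theorem conjTranspose_charDiagonal :
    (charDiagonal ψ v).conjTranspose = charDiagonal ψ (-v) := by
  simp only [charDiagonal, Matrix.diagonal_conjTranspose, Pi.neg_apply, AddChar.map_neg_eq_inv,
    Circle.coe_inv_eq_conj]
  rfl

variable [Fintype σ]

theorem charDiagonal_neg_mul_self : charDiagonal ψ (-v) * charDiagonal ψ v = 1 := by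
  simp [charDiagonal, Matrix.diagonal_mul_diagonal, AddChar.map_neg_eq_inv]

theorem inv_charDiagonal : (charDiagonal ψ v)⁻¹ = charDiagonal ψ (-v) :=
  Matrix.inv_eq_left_inv (charDiagonal_neg_mul_self ψ v)

theorem det_charDiagonal : (charDiagonal ψ v).det = ψ (∑ i, v i) := by
  rw [charDiagonal, Matrix.det_diagonal, coe_addChar_sum]

end CharDiagonal

section Rotation

variable {σ : Type} [Fintype σ] {w : σ → ℝ} {m e : ℝ} {V φ : MvPolynomial σ ℂ}

/-- The isometry `x_i ↦ ψ(w_i) x_i` of `ℂ^σ` given by a character `ψ` of `ℝ` and real weights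
`w`. -/
def charRotation (ψ : AddChar ℝ Circle) (w : σ → ℝ) :
    EuclideanSpace ℂ σ ≃ₗᵢ[ℝ] EuclideanSpace ℂ σ :=
  LinearIsometryEquiv.piLpCongrRight 2 fun i => rotation (ψ (w i))

variable (ψ : AddChar ℝ Circle) (x : EuclideanSpace ℂ σ)

theorem eval_charRotation (hφ : φ.IsWeightedHomogeneous w m) :
    eval (charRotation ψ w x).ofLp φ = ψ m * eval x.ofLp φ :=
  eval_addChar_mul hφ (Circle.coeHom.compAddChar ψ) x.ofLp

theorem eval_pderiv_charRotation (hV : V.IsWeightedHomogeneous w e) (i : σ) :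
    eval (charRotation ψ w x).ofLp (pderiv i V) = ψ (e - w i) * eval x.ofLp (pderiv i V) :=
  eval_charRotation ψ x (hV.pderiv (sub_add_cancel e (w i)))

theorem charRotation_preimage_cycle (hV : V.IsWeightedHomogeneous w e) (ε : ℝ) :
    charRotation ψ w ⁻¹' cycle V ε = cycle V ε := by
  ext x
  simp only [cycle, Set.mem_preimage, Set.mem_ofPred_eq, eval_pderiv_charRotation ψ x hV,
    norm_mul, Circle.norm_coe, one_mul]

open Classical in
theorem hessian_charRotation (hV : V.IsWeightedHomogeneous w e) :
    hessian V (charRotation ψ w x)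
      = charDiagonal ψ (fun i => e - w i) * hessian V x * charDiagonal ψ (-w) := by
  ext i j
  have hpderiv : (pderiv i V).IsWeightedHomogeneous w (e - w i) := hV.pderiv (sub_add_cancel _ _)
  simp only [hessian, charDiagonal, Matrix.of_apply, Matrix.mul_diagonal, Matrix.diagonal_mul,
    eval_pderiv_charRotation ψ x hpderiv, sub_eq_add_neg (e - w i), AddChar.map_add_eq_mul,
    Circle.coe_mul, Pi.neg_apply]
  ring

open Classical in
theorem frame_charRotation (hV : V.IsWeightedHomogeneous w e) :
    frame V (charRotation ψ w x) = charDiagonal ψ w * frame V x := by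
  have hgrad : (Matrix.diagonal fun j => Complex.I * eval (charRotation ψ w x).ofLp (pderiv j V))
      = charDiagonal ψ (fun j => e - w j) *
        Matrix.diagonal fun j => Complex.I * eval x.ofLp (pderiv j V) := by
    simp only [charDiagonal, Matrix.diagonal_mul_diagonal, eval_pderiv_charRotation ψ x hV,
      mul_left_comm]
  have hcancel (B : Matrix σ σ ℂ) : charDiagonal ψ (-fun j => e - w j) *
      (charDiagonal ψ (fun j => e - w j) * B) = B := by
    rw [← mul_assoc, charDiagonal_neg_mul_self, one_mul]
  rw [frame, frame, hessian_charRotation ψ x hV, hgrad, Matrix.mul_inv_rev, Matrix.mul_inv_rev,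
    inv_charDiagonal, inv_charDiagonal, neg_neg, mul_assoc, mul_assoc, hcancel]

theorem dxOnTangent_charRotation (hV : V.IsWeightedHomogeneous w e) :
    dxOnTangent V (charRotation ψ w x) = ψ (∑ i, w i) * dxOnTangent V x := by
  classical
  have hgram : (frame V (charRotation ψ w x)).conjTranspose * frame V (charRotation ψ w x)
      = (frame V x).conjTranspose * frame V x := by
    rw [frame_charRotation ψ x hV, Matrix.conjTranspose_mul, mul_assoc,
      ← mul_assoc (charDiagonal ψ w).conjTranspose, conjTranspose_charDiagonal,
      charDiagonal_neg_mul_self, one_mul]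
  rw [dxOnTangent, dxOnTangent, hgram, frame_charRotation ψ x hV, Matrix.det_mul,
    det_charDiagonal, mul_div_assoc]

/-- The density of `φ dx / (∂_1 V ⋯ ∂_n V)` on `cycle V ε` with respect to Hausdorff measure, as
integrated in `residue`. -/
def residueDensity (V φ : MvPolynomial σ ℂ) (x : EuclideanSpace ℂ σ) : ℂ :=
  eval x.ofLp φ / (∏ i, eval x.ofLp (pderiv i V)) * dxOnTangent V x

theorem residueDensity_charRotation (hV : V.IsWeightedHomogeneous w e)
    (hφ : φ.IsWeightedHomogeneous w m) :
    residueDensity V φ (charRotation ψ w x)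
      = ψ (m - ∑ i, (e - 2 * w i)) * residueDensity V φ x := by
  have hdegree : m - ∑ i, (e - 2 * w i) = m - ∑ i, (e - w i) + ∑ i, w i := by
    simp only [Finset.sum_sub_distrib, ← Finset.mul_sum]
    ring
  rw [residueDensity, residueDensity, eval_charRotation ψ x hφ, dxOnTangent_charRotation ψ x hV,
    hdegree, AddChar.map_add_eq_mul, AddChar.map_sub_eq_div, Circle.coe_mul, Circle.coe_div,
    coe_addChar_sum ψ fun i => e - w i]
  simp only [eval_pderiv_charRotation ψ x hV, Finset.prod_mul_distrib]
  rw [mul_div_mul_comm]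
  ring

theorem residue_eq_char_mul_residue (hV : V.IsWeightedHomogeneous w e)
    (hφ : φ.IsWeightedHomogeneous w m) (ε : ℝ) :
    residue V ε φ = ψ (m - ∑ i, (e - 2 * w i)) * residue V ε φ := by
  let ρ := (charRotation ψ w).toIsometryEquiv
  have hcycle : ρ ⁻¹' cycle V ε = cycle V ε := charRotation_preimage_cycle ψ hV ε
  have hchange := (ρ.measurePreserving_euclideanHausdorffMeasure (Fintype.card σ)
    ).setIntegral_preimage_emb ρ.toHomeomorph.measurableEmbedding (residueDensity V φ) (cycle V ε)
  have hintegral : ∫ x in cycle V ε, residueDensity V φ x ∂μHE[Fintype.card σ]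
      = ψ (m - ∑ i, (e - 2 * w i)) *
        ∫ x in cycle V ε, residueDensity V φ x ∂μHE[Fintype.card σ] :=
    calc _ = ∫ x in cycle V ε, residueDensity V φ (ρ x) ∂μHE[Fintype.card σ] := by
          rw [← hchange, hcycle]
      _ = ∫ x in cycle V ε, ψ (m - ∑ i, (e - 2 * w i)) * residueDensity V φ x
            ∂μHE[Fintype.card σ] := by
          congr with x
          exact residueDensity_charRotation ψ x hV hφ
      _ = _ := integral_const_mul ..
  rw [residue, mul_left_comm]
  exact congrArg _ hintegral

/-- The right-hand side is the degree of the Hessian determinant of `V`. -/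
theorem degree_eq_of_residue_ne_zero (hV : V.IsWeightedHomogeneous w e)
    (hφ : φ.IsWeightedHomogeneous w m) {ε : ℝ} (h : residue V ε φ ≠ 0) :
    m = ∑ i, (e - 2 * w i) := by
  by_contra hne
  obtain ⟨ψ, hψ⟩ := exists_addChar_ne_one (sub_ne_zero.2 hne)
  refine hψ (Circle.coe_eq_one.1 ?_)
  exact mul_right_cancel₀ h ((residue_eq_char_mul_residue ψ hV hφ ε).symm.trans (one_mul _).symm)

end Rotation

section Age

variable {N : ℕ} (g : Fin N → Circle) (i : Fin N)

theorem exp_two_pi_mul_phase : Circle.exp (2 * Real.pi * phase g i) = g i := by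
  rw [phase, Int.fract, mul_sub, Circle.exp_sub, Circle.exp_two_pi_mul_int, div_one,
    mul_div_cancel₀ _ Real.two_pi_pos.ne', Circle.exp_arg]

theorem phase_eq_zero_iff : phase g i = 0 ↔ g i = 1 := by
  refine ⟨fun h => ?_, fun h => by simp [phase, h]⟩
  rw [← exp_two_pi_mul_phase g i, h, mul_zero, Circle.exp_zero]

open Classical in
theorem phase_add_phase_inv : phase g i + phase g⁻¹ i = if g i = 1 then 0 else 1 := by
  split_ifs with hg
  · rw [(phase_eq_zero_iff g i).2 hg, (phase_eq_zero_iff g⁻¹ i).2 (by simp [hg]), add_zero]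
  obtain ⟨k, hk⟩ : ∃ k : ℤ, phase g i + phase g⁻¹ i = k := by
    have hexp : Circle.exp (2 * Real.pi * (phase g i + phase g⁻¹ i)) = 1 := by
      rw [mul_add, Circle.exp_add, exp_two_pi_mul_phase, exp_two_pi_mul_phase, Pi.inv_apply,
        mul_inv_cancel]
    obtain ⟨k, hk⟩ := Circle.exp_eq_one.1 hexp
    exact ⟨k, mul_left_cancel₀ Real.two_pi_pos.ne' (hk.trans (mul_comm _ _))⟩
  have hpos : 0 < phase g i :=
    (Int.fract_nonneg _).lt_of_ne' (mt (phase_eq_zero_iff g i).1 hg)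
  have hlt : phase g i < 1 := Int.fract_lt_one _
  have hinv_nonneg : 0 ≤ phase g⁻¹ i := Int.fract_nonneg _
  have hinv_lt : phase g⁻¹ i < 1 := Int.fract_lt_one _
  have hk_pos : 0 < k := by exact_mod_cast (by linarith : (0 : ℝ) < k)
  have hk_lt : k < 2 := by exact_mod_cast (by linarith : (k : ℝ) < 2)
  rw [hk, show k = 1 by omega, Int.cast_one]

theorem age_add_age_inv : age g + age g⁻¹ = N - (fixIdx g).card := by
  classical
  have hcard : ((fixIdx g).card : ℝ) = ∑ i, if g i = 1 then 1 else 0 := by simp [fixIdx]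
  have hN : (N : ℝ) = ∑ _i : Fin N, 1 := by simp
  rw [age, age, ← Finset.sum_add_distrib, hcard, hN, ← Finset.sum_sub_distrib]
  refine Finset.sum_congr rfl fun i _ => ?_
  rw [phase_add_phase_inv]
  split_ifs <;> norm_num

end Age

section Sectors

variable {N d : ℕ} {W : MvPolynomial (Fin N) ℂ} {c : Fin N → ℕ} {g : Fin N → Circle} {ε : ℝ}

theorem isWeightedHomogeneous_charge (hd : d ≠ 0) (hW : W.IsWeightedHomogeneous c d) :
    W.IsWeightedHomogeneous (charge c d) 1 := by
  have h := isWeightedHomogeneous_map_weight hW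
    ((AddMonoidHom.mulRight (d : ℝ)⁻¹).comp (Nat.castAddMonoidHom ℝ))
  have hone : (d : ℝ) * (d : ℝ)⁻¹ = 1 := mul_inv_cancel₀ (Nat.cast_ne_zero.2 hd)
  rwa [← hone]

theorem isWeightedHomogeneous_restrict {M : Type*} [AddCommMonoid M] {w : Fin N → M} {m : M}
    (hW : W.IsWeightedHomogeneous w m) (S : Finset (Fin N)) :
    (restrict W S).IsWeightedHomogeneous (fun i : S => w i) m := by
  refine isWeightedHomogeneous_aeval hW fun i => ?_
  split_ifs with hi
  · exact isWeightedHomogeneous_X ℂ (fun i : S => w i) ⟨i, hi⟩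
  · exact isWeightedHomogeneous_zero ..

theorem castForm_mem_homForms {S T : Finset (Fin N)} (h : T = S) {a : ℝ}
    {φ : MvPolynomial T ℂ} (hφ : φ ∈ homForms c d T a) : castForm h φ ∈ homForms c d S a := by
  subst h
  have hcast : castForm rfl φ = φ := rename_id_apply φ
  rwa [hcast]

theorem degree_add_degree_of_formPairing_ne_zero (hd : d ≠ 0) (hW : W.IsWeightedHomogeneous c d)
    {a b : ℝ} {φ₁ : MvPolynomial (fixIdx g) ℂ} {φ₂ : MvPolynomial (fixIdx g⁻¹) ℂ}
    (h₁ : φ₁ ∈ homForms c d _ a) (h₂ : φ₂ ∈ homForms c d _ b)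
    (h : formPairing W ε g φ₁ φ₂ ≠ 0) : a + b = (fixIdx g).card := by
  have hdegree := degree_eq_of_residue_ne_zero
    (isWeightedHomogeneous_restrict (isWeightedHomogeneous_charge hd hW) _)
    (IsWeightedHomogeneous.mul h₁ (castForm_mem_homForms (fixIdx_inv g) h₂)) h
  rw [Finset.sum_coe_sort (fixIdx g) fun i => 1 - 2 * charge c d i, Finset.sum_sub_distrib,
    ← Finset.mul_sum, Finset.sum_const, nsmul_one] at hdegree
  linarith

theorem shifted_degree_add_of_formPairing_ne_zero (hd : d ≠ 0)
    (hW : W.IsWeightedHomogeneous c d) {a b : ℝ} {φ₁ : MvPolynomial (fixIdx g) ℂ}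
    {φ₂ : MvPolynomial (fixIdx g⁻¹) ℂ} (h₁ : φ₁ ∈ homForms c d _ a)
    (h₂ : φ₂ ∈ homForms c d _ b) (h : formPairing W ε g φ₁ φ₂ ≠ 0) :
    (a + shiftMinus c d g) + (b + shiftMinus c d g⁻¹) = centralCharge c d ∧
      (a + shiftPlus c d g) + (b + shiftPlus c d g⁻¹) = centralCharge c d := by
  have hdegree := degree_add_degree_of_formPairing_ne_zero hd hW h₁ h₂ h
  have hage := age_add_age_inv g
  have hcharge : centralCharge c d = N - 2 * ∑ i, charge c d i := by
    simp [centralCharge, Finset.sum_sub_distrib, Finset.mul_sum]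
  simp only [shiftMinus, shiftPlus, inv_inv, hcharge]
  constructor <;> linarith

theorem formPairing_eq_pairing {φ₁ : MvPolynomial (fixIdx g) ℂ}
    {φ₂ : MvPolynomial (fixIdx g⁻¹) ℂ}
    (h : pairing W ε g (Submodule.Quotient.mk φ₁) (Submodule.Quotient.mk φ₂) ≠ 0) :
    formPairing W ε g φ₁ φ₂
      = pairing W ε g (Submodule.Quotient.mk φ₁) (Submodule.Quotient.mk φ₂) := by
  rw [pairing] at h ⊢
  split_ifs at h ⊢ with hex
  · exact hex.choose_spec φ₁ φ₂ rfl rfl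
  · exact absurd rfl h

theorem pairing_zero_left (ω : Omega W (fixIdx g⁻¹)) : pairing W ε g 0 ω = 0 := by
  obtain ⟨φ, rfl⟩ := Submodule.Quotient.mk_surjective _ ω
  by_contra h
  exact h ((formPairing_eq_pairing (φ₁ := 0) h).symm.trans (by simp [formPairing, residue]))

theorem pairing_zero_right (ω : Omega W (fixIdx g)) : pairing W ε g ω 0 = 0 := by
  obtain ⟨φ, rfl⟩ := Submodule.Quotient.mk_surjective _ ω
  by_contra h
  exact h ((formPairing_eq_pairing (φ₂ := 0) h).symm.trans
    (by simp [formPairing, residue, castForm]))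

theorem exists_homForm_of_mem_omegaBideg {S : Finset (Fin N)} {a b : ℝ} {ω : Omega W S}
    (hω : ω ∈ omegaBideg W c d S a b) (h0 : ω ≠ 0) :
    a = b ∧ ∃ φ ∈ homForms c d S a, Submodule.Quotient.mk φ = ω := by
  rw [omegaBideg] at hω
  split_ifs at hω with hab
  · exact ⟨hab, Submodule.mem_map.1 hω⟩
  · exact absurd ((Submodule.mem_bot ℂ).1 hω) h0

theorem mem_omegaBideg_of_lof_mem {G : Subgroup (Fin N → Circle)} [DecidableEq G]
    {hG : G ≤ maxSymm W} {g : G} {p q : ℝ} {ω : Omega W (fixIdx (g : Fin N → Circle))}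
    (h : DirectSum.lof ℂ G (fun k => Omega W (fixIdx (k : Fin N → Circle))) g ω
      ∈ OmegaGBideg hG c d p q) :
    ω ∈ omegaBideg W c d _ (p - shiftMinus c d g) (q - shiftPlus c d g) := by
  have hcomponent := (Submodule.mem_iInf _).1 h.2 g
  rwa [Submodule.mem_comap, DirectSum.component.lof_self] at hcomponent

end Sectors

end

end LG

theorem mainTheorem2_general {N : ℕ} (W : MvPolynomial (Fin N) ℂ) (c : Fin N → ℕ) (d : ℕ)
    (hd : d ≠ 0) (hW : W.IsWeightedHomogeneous c d) (g : Fin N → Circle) (ε : ℝ) (hε : 0 < ε) :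
    (∀ (a b : ℝ) (φ₁ : MvPolynomial (LG.fixIdx g) ℂ) (φ₂ : MvPolynomial (LG.fixIdx g⁻¹) ℂ),
        φ₁ ∈ LG.homForms c d _ a → φ₂ ∈ LG.homForms c d _ b →
        LG.formPairing W ε g φ₁ φ₂ ≠ 0 →
        (a + LG.shiftMinus c d g) + (b + LG.shiftMinus c d g⁻¹) = LG.centralCharge c d ∧
          (a + LG.shiftPlus c d g) + (b + LG.shiftPlus c d g⁻¹) = LG.centralCharge c d) ∧
    (∀ (p q p' q' : ℝ) (ω₁ : LG.Omega W (LG.fixIdx g)) (ω₂ : LG.Omega W (LG.fixIdx g⁻¹)),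
        ω₁ ∈ LG.omegaBideg W c d _ (p - LG.shiftMinus c d g) (q - LG.shiftPlus c d g) →
        ω₂ ∈ LG.omegaBideg W c d _ (p' - LG.shiftMinus c d g⁻¹) (q' - LG.shiftPlus c d g⁻¹) →
        LG.pairing W ε g ω₁ ω₂ ≠ 0 →
        p + p' = LG.centralCharge c d ∧ q + q' = LG.centralCharge c d) := by
  refine ⟨fun a b φ₁ φ₂ => LG.shifted_degree_add_of_formPairing_ne_zero hd hW, ?_⟩
  intro p q p' q' ω₁ ω₂ h₁ h₂ h
  have hω₁ : ω₁ ≠ 0 := by rintro rfl; exact h (LG.pairing_zero_left ω₂)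
  have hω₂ : ω₂ ≠ 0 := by rintro rfl; exact h (LG.pairing_zero_right ω₁)
  obtain ⟨hdiag₁, φ₁, hφ₁, rfl⟩ := LG.exists_homForm_of_mem_omegaBideg h₁ hω₁
  obtain ⟨hdiag₂, φ₂, hφ₂, rfl⟩ := LG.exists_homForm_of_mem_omegaBideg h₂ hω₂
  rw [← LG.formPairing_eq_pairing h] at h
  obtain ⟨hminus, hplus⟩ := LG.shifted_degree_add_of_formPairing_ne_zero hd hW hφ₁ hφ₂ h
  constructor <;> linarith

open Classical in
theorem mainTheorem2 {N : ℕ} (W : MvPolynomial (Fin N) ℂ) (c : Fin N → ℕ) (d : ℕ)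
    (hW : LG.IsQuasihomogeneous W c d) (hnd : LG.IsNondegenerate W) (hinv : LG.IsInvertible W)
    (G : Subgroup (Fin N → Circle)) (hG : G ≤ LG.maxSymm W) (hJ : LG.J c d ∈ G)
    (g : G) (ε : ℝ) (hε : 0 < ε) :
    -- for homogeneous forms `φ₁ dx_g`, `φ₂ dx_{g⁻¹}` of internal degrees `a`, `b`
    (∀ (a b : ℝ) (φ₁ : MvPolynomial (LG.fixIdx (g : Fin N → Circle)) ℂ)
        (φ₂ : MvPolynomial (LG.fixIdx (g : Fin N → Circle)⁻¹) ℂ),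
        φ₁ ∈ LG.homForms c d _ a → φ₂ ∈ LG.homForms c d _ b →
        LG.formPairing W ε g φ₁ φ₂ ≠ 0 →
        (a + LG.shiftMinus c d g) + (b + LG.shiftMinus c d (g : Fin N → Circle)⁻¹)
            = LG.centralCharge c d ∧
          (a + LG.shiftPlus c d g) + (b + LG.shiftPlus c d (g : Fin N → Circle)⁻¹)
            = LG.centralCharge c d) ∧
    -- for bihomogeneous elements of the `g`- and `g⁻¹`-sectors of `Ω_{W,G}`
    (∀ (p q p' q' : ℝ) (ω₁ : LG.Omega W (LG.fixIdx (g : Fin N → Circle)))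
        (ω₂ : LG.Omega W (LG.fixIdx ((g⁻¹ : G) : Fin N → Circle))),
        DirectSum.lof ℂ G (fun k => LG.Omega W (LG.fixIdx (k : Fin N → Circle))) g ω₁
          ∈ LG.OmegaGBideg hG c d p q →
        DirectSum.lof ℂ G (fun k => LG.Omega W (LG.fixIdx (k : Fin N → Circle))) g⁻¹ ω₂
          ∈ LG.OmegaGBideg hG c d p' q' →
        LG.pairing W ε g ω₁ ω₂ ≠ 0 →
        p + p' = LG.centralCharge c d ∧ q + q' = LG.centralCharge c d) := by
  obtain ⟨forms, classes⟩ := mainTheorem2_general W c d hW.degree_pos.ne' hW.homogeneous g ε hε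
  exact ⟨forms, fun p q p' q' ω₁ ω₂ h₁ h₂ => classes p q p' q' ω₁ ω₂
    (LG.mem_omegaBideg_of_lof_mem h₁) (LG.mem_omegaBideg_of_lof_mem (g := g⁻¹) h₂)⟩
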